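/- **The calculus $\lambda_{\mathsf{MELL}}$.** Formulae are $A,B ::= \alpha \mid \overline{\alpha} \mid A\otimes B \mid A \wp B \mid \mathbf 1 \mid \bot \mid {!A} \mid {?A}$, and $(\cdot)^\perp$ is the usual involutive De Morgan negation ($\wp$ denotes par). There are linear variables $a,b,\dots$ and unrestricted variables $u,\dots$. Terms, up to $\alpha$-renaming, are $$t,s ::= a \mid u \mid \langle t,s\rangle \mid t[\langle a,b\rangle:=s] \mid \wp (a,b).t \mid t\,s \mid t\bullet s \mid \star \mid t[\star:=s] \mid t\perp s \mid {!a.t} \mid t[!u:=s] \mid {?u.t}$$ ($a,b$ resp. $u$ are bound in $t$). Judgements are $\Delta;\Gamma\vdash t:A$, with $\Delta$ an unrestricted and $\Gamma$ a linear environment (partial functions); "$\Gamma,\Gamma'$" is disjoint union. The rules are: * $\Delta;a:A\vdash a:A$; $\quad\Delta,u:A;\cdot\vdash u:A$; $\quad\Delta;\cdot\vdash\star:\mathbf 1$; * if $\Delta;\Gamma\vdash t:A$ and $\Delta;\Gamma'\vdash s:B$, then $\Delta;\Gamma,\Gamma'\vdash\langle t,s\rangle:A\otimes B$; * if $\Delta;\Gamma\vdash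 s:A\otimes B$ and $\Delta;\Gamma',a:A,b:B\vdash t:C$, then $\Delta;\Gamma,\Gamma'\vdash t[\langle a,b\rangle:=s]:C$; * if $\Delta;\Gamma,a:A^\perp,b:B^\perp\vdash t:\bot$, then $\Delta;\Gamma\vdash \wp (a,b).t:A\wp B$; * if $\Delta;\Gamma\vdash t:A\wp B$ and $\Delta;\Gamma'\vdash s:A^\perp$, then $\Delta;\Gamma,\Gamma'\vdash t\,s:B$; if instead $\Delta;\Gamma'\vdash s:B^\perp$, then $\Delta;\Gamma,\Gamma'\vdash t\bullet s:A$; * if $\Delta;\Gamma\vdash s:\mathbf 1$ and $\Delta;\Gamma'\vdash t:A$, then $\Delta;\Gamma,\Gamma'\vdash t[\star:=s]:A$; * if $\Delta;\Gamma\vdash t:A$ and $\Delta;\Gamma'\vdash s:A^\perp$, then $\Delta;\Gamma,\Gamma'\vdash t\perp s:\bot$; * if $\Delta;a:A^\perp\vdash t:\bot$, then $\Delta;\cdot\vdash {!a.t}:{!A}$; * if $\Delta;\Gamma\vdash s:{!A}$ and $\Delta,u:A;\Gamma'\vdash t:B$, then $\Delta;\Gamma,\Gamma'\vdash t[!u:=s]:B$;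 * if $\Delta,u:A^\perp;\Gamma\vdash t:\bot$, then $\Delta;\Gamma\vdash {?u.t}:{?A}$. A term is *linear* if no free linear variable occurs twice, every bound linear variable occurs exactly once in its scope, and no subterm $!a.t$ has a free linear variable. For a linear $t$ with a free linear variable $a$, *contra-substitution* $t\{a\backslash\!\backslash s\}$ is defined (avoiding capture) by $a\{a\backslash\!\backslash s\}=s$ and: * $\langle t_1,t_2\rangle\{a\backslash\!\backslash s\}$ is $t_1\{a\backslash\!\backslash s\bullet t_2\}$ if $a\in t_1$, and $t_2\{a\backslash\!\backslash s\,t_1\}$ if $a\in t_2$; * $(t_1t_2)\{a\backslash\!\backslash s\}$ is $t_1\{a\backslash\!\backslash\langle t_2,s\rangle\}$ if $a\in t_1$, and $t_2\{a\backslash\!\backslash t_1\bullet s\}$ if $a\in t_2$; * $(t_1\bullet t_2)\{a\backslash\!\backslash s\}$ is $t_1\{a\backslash\!\backslash\langle s,t_2\rangle\}$ if $a\in t_1$, and $t_2\{a\backslash\!\backslash t_1\,s\}$ if $a\in t_2$; * $(t_1\perp t_2)\{a\backslash\!\backslash s\}$ is $t_1\{a\backslash\!\backslash t_2[\star:=s]\}$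 if $a\in t_1$, and $t_2\{a\backslash\!\backslash t_1[\star:=s]\}$ if $a\in t_2$; * $(\wp (b,c).t)\{a\backslash\!\backslash s\}=t\{a\backslash\!\backslash\star\}[\langle b,c\rangle:=s]$ and $(?u.t)\{a\backslash\!\backslash s\}=t\{a\backslash\!\backslash\star\}[!u:=s]$; * for $E$ one of $[\langle b,c\rangle:=r]$, $[\star:=r]$, $[!u:=r]$: $(tE)\{a\backslash\!\backslash s\}=t\{a\backslash\!\backslash s\}E$ if $a\in t$; and if $a\in r$ it is, respectively, $r\{a\backslash\!\backslash \wp (b,c).(t\perp s)\}$, $r\{a\backslash\!\backslash t\perp s\}$, $r\{a\backslash\!\backslash {?u.(t\perp s)}\}$. With $L::=\Box\mid L[\langle a,b\rangle:=s]\mid L[\star:=s]\mid L[!u:=s]$, and $tL$ denoting $L$ with its hole filled by $t$, reduction $\to$ is the closure under all term contexts of the following axioms, on linear terms (no capture of variables of the terms that move under $L$, $L'$): * $(\wp (a,b).t)L\;s\to t\{a:=s\}\{b\backslash\!\backslash\star\}L$ and $(\wp (a,b).t)L\bullet s\to t\{b:=s\}\{a\backslash\!\backslash\star\}L$; * $t[\langle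 a,b\rangle:=\langle s,r\rangle L]\to t\{a:=s\}\{b:=r\}L$, $\quad t[\star:=\star L]\to tL$, $\quad t[!u:=(!a.s)L]\to t\{u:=s\{a\backslash\!\backslash\star\}\}L$; * $(\wp (a,b).t)L\perp\langle s,r\rangle L'\to t\{a:=s\}\{b:=r\}L'L$, $\quad(?u.t)L\perp(!a.s)L'\to t\{u:=s\{a\backslash\!\backslash\star\}\}L'L$, $\quad t\perp\star L\to tL$, and the same three with the two sides of $\perp$ on the left of the arrow exchanged. $\twoheadrightarrow$ is the reflexive–transitive closure of $\to$. **The calculus $\bar\lambda\mu\tilde\mu$** (in the version without the binder $\tilde\mu$). Types are $A::=\alpha\mid A\supset B$; terms $v::=x\mid\mu\alpha.c\mid\lambda x.v$; co-terms $e::=\alpha\mid v\cdot e$; commands $c::=\langle v\,|\,e\rangle$. Typing: $\Gamma,x:A\vdash x:A\mid\Delta$; $\;\Gamma\mid\alpha:A\vdash\alpha:A,\Delta$; from $c:(\Gamma\vdash\alpha:B,\Delta)$ infer $\Gamma\vdash\mu\alpha.c:B\mid\Delta$; from $\Gamma,x:A\vdash v:B\mid\Delta$ infer $\Gamma\vdash\lambda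 x.v:A\supset B\mid\Delta$; from $\Gamma\vdash v:A\mid\Delta$ and $\Gamma\mid e:B\vdash\Delta$ infer $\Gamma\mid v\cdot e:A\supset B\vdash\Delta$; from $\Gamma\vdash v:A\mid\Delta$ and $\Gamma\mid e:A\vdash\Delta$ infer $\langle v|e\rangle:(\Gamma\vdash\Delta)$. Reduction is the contextual closure, on terms, co-terms and commands, of $\langle\lambda x.v_1|v_2\cdot e\rangle\to\langle v_1\{x:=v_2\}|e\rangle$ and $\langle\mu\alpha.c|e\rangle\to c\{\alpha:=e\}$. **The T-translation.** Let $!t:={!a.(t\perp a)}$ with $a$ fresh. On types, $\alpha^{T}=\alpha$ and $(A\supset B)^{T}={?!(A^{T})^\perp}\wp {?B^{T}}$. On expressions (variables and co-variables become pairwise distinct unrestricted variables): $x^T=x$, $(\mu\alpha.c)^T={?\alpha.c^T}$, $(\lambda x.v)^T={?u.\big(u\perp \wp (a,b).((v^T\perp b)[!x:=a])\big)}$, $\alpha^T={!\alpha}$, $(v\cdot e)^T={!\langle{!v^T},e^T\rangle}$, $\langle v|e\rangle^T=v^T\perp e^T$. **Proposition.** (Type preservation.) 1. If $c:(\Gamma\vdash\Delta)$,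 then ${?\Gamma^T},(\Delta^T)^\perp;\cdot\vdash c^T:\bot$. 2. If $\Gamma\mid e:A\vdash\Delta$, then ${?\Gamma^T},(\Delta^T)^\perp;\cdot\vdash e^T:{!(A^T)^\perp}$. 3. If $\Gamma\vdash v:A\mid\Delta$, then ${?\Gamma^T},(\Delta^T)^\perp;\cdot\vdash v^T:{?A^T}$. (Simulation.) If $t\to s$ in $\bar\lambda\mu\tilde\mu$, where $t$ and $s$ are two (not necessarily typed) terms, co-terms or commands, then $t^T\twoheadrightarrow s^T$ in $\lambda_{\mathsf{MELL}}$. -/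

import Mathlib

/-! # The calculus `λ_MELL`

Binders are represented by de Bruijn indices, so that terms are literally terms up to renaming of
bound variables.  Linear and unrestricted variables live in two separate index spaces. -/

namespace MELL

/-- Formulae of multiplicative exponential linear logic; `natom n` is the negated atom. -/
inductive Formula : Type
  | atom (n : ℕ)
  | natom (n : ℕ)
  | tensor (A B : Formula)
  | par (A B : Formula)
  | one
  | bot
  | ofc (A : Formula)
  | why (A : Formula)

/-- Linear negation. -/
def Formula.neg : Formula → Formula
  | .atom n => .natom n
  | .natom n => .atom n
  | .tensor A B => .par A.neg B.neg
  | .par A B => .tensor A.neg B.neg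
  | .one => .bot
  | .bot => .one
  | .ofc A => .why A.neg
  | .why A => .ofc A.neg

/-- Terms.  In `letPair s t` and `par t`, the two bound linear variables `a`, `b` have the
indices `1` and `0` (in this order) in `t`. -/
inductive Term : Type
  /-- linear variable -/
  | lvar (n : ℕ)
  /-- unrestricted variable -/
  | uvar (n : ℕ)
  /-- tensor introduction `⟨t, s⟩` -/
  | pair (t s : Term)
  /-- tensor elimination `t[⟨a,b⟩ := s]`, binding the linear variables `a`, `b` in `t` -/
  | letPair (s t : Term)
  /-- par introduction `⅋(a,b).t`, binding the linear variables `a`, `b` in `t` -/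
  | par (t : Term)
  /-- application (first elimination of par) -/
  | app (t s : Term)
  /-- contra-application (second elimination of par) -/
  | coapp (t s : Term)
  /-- introduction of the unit `1` -/
  | star
  /-- elimination of the unit `t[⋆ := s]` -/
  | letStar (s t : Term)
  /-- introduction of bottom `t ⊥ s` -/
  | cut (t s : Term)
  /-- of-course introduction `!a.t`, binding the linear variable `a` in `t` -/
  | ofc (t : Term)
  /-- of-course elimination `t[!u := s]`, binding the unrestricted variable `u` in `t` -/
  | letOfc (s t : Term)
  /-- why-not introduction `?u.t`, binding the unrestricted variable `u` in `t` -/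
  | why (t : Term)

/-- A renaming pushed under a binder. -/
def upRen (ξ : ℕ → ℕ) : ℕ → ℕ
  | 0 => 0
  | n + 1 => ξ n + 1

namespace Term

/-- Renaming of the free variables: `ξ` acts on unrestricted, `ζ` on linear variables. -/
def rename : (ξ ζ : ℕ → ℕ) → Term → Term
  | _, ζ, lvar n => lvar (ζ n)
  | ξ, _, uvar n => uvar (ξ n)
  | ξ, ζ, pair t s => pair (t.rename ξ ζ) (s.rename ξ ζ)
  | ξ, ζ, letPair s t => letPair (s.rename ξ ζ) (t.rename ξ (upRen (upRen ζ)))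
  | ξ, ζ, par t => par (t.rename ξ (upRen (upRen ζ)))
  | ξ, ζ, app t s => app (t.rename ξ ζ) (s.rename ξ ζ)
  | ξ, ζ, coapp t s => coapp (t.rename ξ ζ) (s.rename ξ ζ)
  | _, _, star => star
  | ξ, ζ, letStar s t => letStar (s.rename ξ ζ) (t.rename ξ ζ)
  | ξ, ζ, cut t s => cut (t.rename ξ ζ) (s.rename ξ ζ)
  | ξ, ζ, ofc t => ofc (t.rename ξ (upRen ζ))
  | ξ, ζ, letOfc s t => letOfc (s.rename ξ ζ) (t.rename (upRen ξ) ζ)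
  | ξ, ζ, why t => why (t.rename (upRen ξ) ζ)

/-- Weakening by `i` unrestricted and `j` linear variables. -/
def shift (i j : ℕ) (t : Term) : Term := t.rename (· + i) (· + j)

/-- `scons s σ` sends the index `0` to `s` and `n + 1` to `σ n`. -/
def scons (s : Term) (σ : ℕ → Term) : ℕ → Term
  | 0 => s
  | n + 1 => σ n

/-- Simultaneous capture-avoiding substitution: `σ` for the unrestricted variables,
`τ` for the linear variables. -/
def subst : (σ τ : ℕ → Term) → Term → Term
  | _, τ, lvar n => τ n
  | σ, _, uvar n => σ n
  | σ, τ, pair t s => pair (t.subst σ τ) (s.subst σ τ)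
  | σ, τ, letPair s t => letPair (s.subst σ τ)
      (t.subst (fun n => (σ n).shift 0 2)
        (scons (lvar 0) (scons (lvar 1) (fun n => (τ n).shift 0 2))))
  | σ, τ, par t => par
      (t.subst (fun n => (σ n).shift 0 2)
        (scons (lvar 0) (scons (lvar 1) (fun n => (τ n).shift 0 2))))
  | σ, τ, app t s => app (t.subst σ τ) (s.subst σ τ)
  | σ, τ, coapp t s => coapp (t.subst σ τ) (s.subst σ τ)
  | _, _, star => star
  | σ, τ, letStar s t => letStar (s.subst σ τ) (t.subst σ τ)
  | σ, τ, cut t s => cut (t.subst σ τ) (s.subst σ τ)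
  | σ, τ, ofc t => ofc
      (t.subst (fun n => (σ n).shift 0 1) (scons (lvar 0) (fun n => (τ n).shift 0 1)))
  | σ, τ, letOfc s t => letOfc (s.subst σ τ)
      (t.subst (scons (uvar 0) (fun n => (σ n).shift 1 0)) (fun n => (τ n).shift 1 0))
  | σ, τ, why t => why
      (t.subst (scons (uvar 0) (fun n => (σ n).shift 1 0)) (fun n => (τ n).shift 1 0))

/-- Number of free occurrences of the linear variable with index `a`. -/
def occ : Term → ℕ → ℕ
  | lvar n, a => if n = a then 1 else 0
  | uvar _, _ => 0
  | pair t s, a => t.occ a + s.occ a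
  | letPair s t, a => s.occ a + t.occ (a + 2)
  | par t, a => t.occ (a + 2)
  | app t s, a => t.occ a + s.occ a
  | coapp t s, a => t.occ a + s.occ a
  | star, _ => 0
  | letStar s t, a => s.occ a + t.occ a
  | cut t s, a => t.occ a + s.occ a
  | ofc t, a => t.occ (a + 1)
  | letOfc s t, a => s.occ a + t.occ a
  | why t, a => t.occ a

/-- Linear terms: no free linear variable occurs twice, every bound linear variable occurs exactly
once in its scope, and no linear variable is free in a term of the form `!a.t`. -/
def Linear : Term → Prop
  | lvar _ => True
  | uvar _ => True
  | pair t s => t.Linear ∧ s.Linear ∧ ∀ a, t.occ a = 0 ∨ s.occ a = 0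
  | letPair s t => s.Linear ∧ t.Linear ∧ t.occ 0 = 1 ∧ t.occ 1 = 1 ∧
      ∀ a, s.occ a = 0 ∨ t.occ (a + 2) = 0
  | par t => t.Linear ∧ t.occ 0 = 1 ∧ t.occ 1 = 1
  | app t s => t.Linear ∧ s.Linear ∧ ∀ a, t.occ a = 0 ∨ s.occ a = 0
  | coapp t s => t.Linear ∧ s.Linear ∧ ∀ a, t.occ a = 0 ∨ s.occ a = 0
  | star => True
  | letStar s t => s.Linear ∧ t.Linear ∧ ∀ a, s.occ a = 0 ∨ t.occ a = 0
  | cut t s => t.Linear ∧ s.Linear ∧ ∀ a, t.occ a = 0 ∨ s.occ a = 0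
  | ofc t => t.Linear ∧ t.occ 0 = 1 ∧ ∀ a, t.occ (a + 1) = 0
  | letOfc s t => s.Linear ∧ t.Linear ∧ ∀ a, s.occ a = 0 ∨ t.occ a = 0
  | why t => t.Linear

open Classical in
/-- Contra-substitution `t{a \\ s}`, for a linear term `t` in which the linear variable `a` is free
and a term `s` in which it is not.  (On other arguments the value is immaterial.)
The result does not contain `a` any more; the indices of the other variables are unchanged. -/
noncomputable def contra : Term → ℕ → Term → Term
  | lvar _, _, s => s
  | uvar n, _, _ => uvar n
  | pair t₁ t₂, a, s =>
      if t₁.occ a ≠ 0 then t₁.contra a (coapp s t₂) else t₂.contra a (app s t₁)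
  | letPair t₁ t₂, a, s =>
      if t₁.occ a ≠ 0 then t₁.contra a (par (cut t₂ (s.shift 0 2)))
      else letPair t₁ (t₂.contra (a + 2) (s.shift 0 2))
  | par t, a, s => letPair s (t.contra (a + 2) star)
  | app t₁ t₂, a, s =>
      if t₁.occ a ≠ 0 then t₁.contra a (pair t₂ s) else t₂.contra a (coapp t₁ s)
  | coapp t₁ t₂, a, s =>
      if t₁.occ a ≠ 0 then t₁.contra a (pair s t₂) else t₂.contra a (app t₁ s)
  | star, _, _ => star
  | letStar t₁ t₂, a, s =>
      if t₁.occ a ≠ 0 then t₁.contra a (cut t₂ s) else letStar t₁ (t₂.contra a s)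
  | cut t₁ t₂, a, s =>
      if t₁.occ a ≠ 0 then t₁.contra a (letStar s t₂) else t₂.contra a (letStar s t₁)
  | ofc t, _, _ => ofc t
  | letOfc t₁ t₂, a, s =>
      if t₁.occ a ≠ 0 then t₁.contra a (why (cut t₂ (s.shift 1 0)))
      else letOfc t₁ (t₂.contra a (s.shift 1 0))
  | why t, a, s => letOfc s (t.contra a star)

/-- `t{a \\ ⋆}` for the linear variable `a` of index `0`, which is then removed from the
context. -/
noncomputable def contraStar (t : Term) : Term := (t.contra 0 star).rename id Nat.pred

/-- `!t`, an abbreviation for `!a.(t ⊥ a)` with `a` fresh. -/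
def bang (t : Term) : Term := ofc (cut (t.shift 0 1) (lvar 0))

end Term

/-! ## Typing -/

/-- Typing environments: partial functions from variables to formulae. -/
abbrev Ctx : Type := ℕ → Option Formula

/-- `Γ, 0 : A`, the variables of `Γ` being shifted by one. -/
def Ctx.cons (A : Formula) (Γ : Ctx) : Ctx
  | 0 => some A
  | n + 1 => Γ n

/-- The empty environment. -/
def Ctx.empty : Ctx := fun _ => none

/-- The environment `a : A`. -/
def Ctx.single (a : ℕ) (A : Formula) : Ctx := fun n => if n = a then some A else none

/-- `Γ` is the union `Γ₁, Γ₂` of two environments with disjoint domains. -/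
def Ctx.Split (Γ Γ₁ Γ₂ : Ctx) : Prop :=
  ∀ n, (Γ₁ n = none ∧ Γ n = Γ₂ n) ∨ (Γ₂ n = none ∧ Γ n = Γ₁ n)

/-- `Typed Δ Γ t A` is the judgement `Δ; Γ ⊢ t : A`, with unrestricted environment `Δ` and
linear environment `Γ`. -/
inductive Typed : Ctx → Ctx → Term → Formula → Prop
  | ax {Δ a A} : Typed Δ (Ctx.single a A) (.lvar a) A
  | uax {Δ u A} : Δ u = some A → Typed Δ Ctx.empty (.uvar u) A
  | tensorI {Δ Γ Γ₁ Γ₂ t s A B} : Ctx.Split Γ Γ₁ Γ₂ → Typed Δ Γ₁ t A → Typed Δ Γ₂ s B →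
      Typed Δ Γ (.pair t s) (.tensor A B)
  | tensorE {Δ Γ Γ₁ Γ₂ s t A B C} : Ctx.Split Γ Γ₁ Γ₂ → Typed Δ Γ₁ s (.tensor A B) →
      Typed Δ (Ctx.cons B (Ctx.cons A Γ₂)) t C → Typed Δ Γ (.letPair s t) C
  | parI {Δ Γ t A B} : Typed Δ (Ctx.cons B.neg (Ctx.cons A.neg Γ)) t .bot →
      Typed Δ Γ (.par t) (.par A B)
  | parE₁ {Δ Γ Γ₁ Γ₂ t s A B} : Ctx.Split Γ Γ₁ Γ₂ → Typed Δ Γ₁ t (.par A B) →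
      Typed Δ Γ₂ s A.neg → Typed Δ Γ (.app t s) B
  | parE₂ {Δ Γ Γ₁ Γ₂ t s A B} : Ctx.Split Γ Γ₁ Γ₂ → Typed Δ Γ₁ t (.par A B) →
      Typed Δ Γ₂ s B.neg → Typed Δ Γ (.coapp t s) A
  | oneI {Δ} : Typed Δ Ctx.empty .star .one
  | oneE {Δ Γ Γ₁ Γ₂ s t A} : Ctx.Split Γ Γ₁ Γ₂ → Typed Δ Γ₁ s .one → Typed Δ Γ₂ t A →
      Typed Δ Γ (.letStar s t) A
  | botI {Δ Γ Γ₁ Γ₂ t s A} : Ctx.Split Γ Γ₁ Γ₂ → Typed Δ Γ₁ t A → Typed Δ Γ₂ s A.neg →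
      Typed Δ Γ (.cut t s) .bot
  | ofcI {Δ t A} : Typed Δ (Ctx.cons A.neg Ctx.empty) t .bot → Typed Δ Ctx.empty (.ofc t) (.ofc A)
  | ofcE {Δ Γ Γ₁ Γ₂ s t A B} : Ctx.Split Γ Γ₁ Γ₂ → Typed Δ Γ₁ s (.ofc A) →
      Typed (Ctx.cons A Δ) Γ₂ t B → Typed Δ Γ (.letOfc s t) B
  | whyI {Δ Γ t A} : Typed (Ctx.cons A.neg Δ) Γ t .bot → Typed Δ Γ (.why t) (.why A)

/-! ## Reduction -/

/-- Elimination contexts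
`L ::= □ | L[⟨a,b⟩ := s] | L[⋆ := s] | L[!u := s]`. -/
inductive ECtx : Type
  | hole
  | letPair (s : Term) (L : ECtx)
  | letStar (s : Term) (L : ECtx)
  | letOfc (s : Term) (L : ECtx)

namespace ECtx

/-- Filling the hole, with capture. -/
def plug : ECtx → Term → Term
  | hole, t => t
  | letPair s L, t => .letPair s (L.plug t)
  | letStar s L, t => .letStar s (L.plug t)
  | letOfc s L, t => .letOfc s (L.plug t)

/-- Number of unrestricted variables bound at the hole. -/
def nu : ECtx → ℕ
  | hole => 0
  | letPair _ L => L.nu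
  | letStar _ L => L.nu
  | letOfc _ L => L.nu + 1

/-- Number of linear variables bound at the hole. -/
def nl : ECtx → ℕ
  | hole => 0
  | letPair _ L => L.nl + 2
  | letStar _ L => L.nl
  | letOfc _ L => L.nl

/-- Renaming of the free variables. -/
def rename : (ξ ζ : ℕ → ℕ) → ECtx → ECtx
  | _, _, hole => hole
  | ξ, ζ, letPair s L => letPair (s.rename ξ ζ) (L.rename ξ (upRen (upRen ζ)))
  | ξ, ζ, letStar s L => letStar (s.rename ξ ζ) (L.rename ξ ζ)
  | ξ, ζ, letOfc s L => letOfc (s.rename ξ ζ) (L.rename (upRen ξ) ζ)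

end ECtx

open Term in
/-- The reduction axioms (at a distance).  The shifts are the weakenings that make each term
capture-avoiding at its new place. -/
inductive Root : Term → Term → Prop
  /-- `(⅋(a,b).t)L s ⟶ t{a := s}{b \\ ⋆}L` -/
  | parL (L : ECtx) (t s : Term) :
      Root (app (L.plug (par t)) s)
        (L.plug (contraStar (t.subst uvar
          (scons (lvar 0) (scons (s.shift L.nu (L.nl + 1)) (fun n => lvar (n + 1)))))))
  /-- contra-application of `(⅋(a,b).t)L` to `s` reduces to `t{b := s}{a \\ ⋆}L` -/
  | parR (L : ECtx) (t s : Term) :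
      Root (coapp (L.plug (par t)) s)
        (L.plug (contraStar (t.subst uvar
          (scons (s.shift L.nu (L.nl + 1)) (scons (lvar 0) (fun n => lvar (n + 1)))))))
  /-- `t[⟨a,b⟩ := ⟨s,r⟩L] ⟶ t{a := s}{b := r}L` -/
  | tensor (L : ECtx) (t s r : Term) :
      Root (letPair (L.plug (pair s r)) t)
        (L.plug (t.subst (fun n => uvar (n + L.nu))
          (scons r (scons s (fun n => lvar (n + L.nl))))))
  /-- `t[⋆ := ⋆L] ⟶ tL` -/
  | one (L : ECtx) (t : Term) :
      Root (letStar (L.plug star) t) (L.plug (t.shift L.nu L.nl))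
  /-- `t[!u := (!a.s)L] ⟶ t{u := s{a \\ ⋆}}L` -/
  | ofc (L : ECtx) (t s : Term) :
      Root (letOfc (L.plug (ofc s)) t)
        (L.plug (t.subst (scons (contraStar s) (fun n => uvar (n + L.nu)))
          (fun n => lvar (n + L.nl))))
  /-- `(⅋(a,b).t)L ⊥ ⟨s,r⟩L' ⟶ t{a := s}{b := r}L'L` -/
  | cutPar (L L' : ECtx) (t s r : Term) :
      Root (cut (L.plug (par t)) (L'.plug (pair s r)))
        (L.plug ((L'.rename (· + L.nu) (· + L.nl)).plug
          (t.subst (fun n => uvar (n + L'.nu))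
            (scons (r.rename (upRen^[L'.nu] (· + L.nu)) (upRen^[L'.nl] (· + L.nl)))
              (scons (s.rename (upRen^[L'.nu] (· + L.nu)) (upRen^[L'.nl] (· + L.nl)))
                (fun n => lvar (n + L'.nl)))))))
  /-- `(?u.t)L ⊥ (!a.s)L' ⟶ t{u := s{a \\ ⋆}}L'L` -/
  | cutWhy (L L' : ECtx) (t s : Term) :
      Root (cut (L.plug (why t)) (L'.plug (ofc s)))
        (L.plug ((L'.rename (· + L.nu) (· + L.nl)).plug
          (t.subst
            (scons
              ((contraStar s).rename (upRen^[L'.nu] (· + L.nu)) (upRen^[L'.nl] (· + L.nl)))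
              (fun n => uvar (n + L'.nu)))
            (fun n => lvar (n + L'.nl)))))
  /-- `t ⊥ ⋆L ⟶ tL` -/
  | cutOne (L : ECtx) (t : Term) :
      Root (cut t (L.plug star)) (L.plug (t.shift L.nu L.nl))
  /-- the two sides of `t ⊥ s` play symmetric roles -/
  | cutSymm {t s r : Term} : Root (cut t s) r → Root (cut s t) r

open Term in
/-- Reduction: the contextual closure of the axioms, on linear terms. -/
inductive Step : Term → Term → Prop
  | root {t s} : t.Linear → Root t s → Step t s
  | pair₁ {t t' s} : Step t t' → Step (pair t s) (pair t' s)
  | pair₂ {t s s'} : Step s s' → Step (pair t s) (pair t s')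
  | letPair₁ {s s' t} : Step s s' → Step (letPair s t) (letPair s' t)
  | letPair₂ {s t t'} : Step t t' → Step (letPair s t) (letPair s t')
  | par {t t'} : Step t t' → Step (par t) (par t')
  | app₁ {t t' s} : Step t t' → Step (app t s) (app t' s)
  | app₂ {t s s'} : Step s s' → Step (app t s) (app t s')
  | coapp₁ {t t' s} : Step t t' → Step (coapp t s) (coapp t' s)
  | coapp₂ {t s s'} : Step s s' → Step (coapp t s) (coapp t s')
  | letStar₁ {s s' t} : Step s s' → Step (letStar s t) (letStar s' t)
  | letStar₂ {s t t'} : Step t t' → Step (letStar s t) (letStar s t')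
  | cut₁ {t t' s} : Step t t' → Step (cut t s) (cut t' s)
  | cut₂ {t s s'} : Step s s' → Step (cut t s) (cut t s')
  | ofc {t t'} : Step t t' → Step (ofc t) (ofc t')
  | letOfc₁ {s s' t} : Step s s' → Step (letOfc s t) (letOfc s' t)
  | letOfc₂ {s t t'} : Step t t' → Step (letOfc s t) (letOfc s t')
  | why {t t'} : Step t t' → Step (why t) (why t')

end MELL

/-! # The calculus of Curien and Herbelin

Variables and co-variables live in two separate spaces of de Bruijn indices. -/

namespace CH

/-- Types. -/
inductive Ty : Type
  | atom (n : ℕ)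
  | imp (A B : Ty)

/-- The three syntactic categories: terms, co-terms, commands. -/
inductive Kind : Type
  | tm
  | co
  | cmd

/-- Expressions of each syntactic category. -/
inductive Expr : Kind → Type
  /-- variable `x` -/
  | var (n : ℕ) : Expr .tm
  /-- `μα.c`, binding the co-variable `α` in `c` -/
  | mu (c : Expr .cmd) : Expr .tm
  /-- `λx.v`, binding the variable `x` in `v` -/
  | lam (v : Expr .tm) : Expr .tm
  /-- co-variable `α` -/
  | covar (n : ℕ) : Expr .co
  /-- `v · e` -/
  | app (v : Expr .tm) (e : Expr .co) : Expr .co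
  /-- `⟨v | e⟩` -/
  | cut (v : Expr .tm) (e : Expr .co) : Expr .cmd

namespace Expr

/-- Renaming of the free variables (`ξ`) and co-variables (`ζ`). -/
def rename : {k : Kind} → (ξ ζ : ℕ → ℕ) → Expr k → Expr k
  | _, ξ, _, var n => var (ξ n)
  | _, ξ, ζ, mu c => mu (c.rename ξ (MELL.upRen ζ))
  | _, ξ, ζ, lam v => lam (v.rename (MELL.upRen ξ) ζ)
  | _, _, ζ, covar n => covar (ζ n)
  | _, ξ, ζ, app v e => app (v.rename ξ ζ) (e.rename ξ ζ)
  | _, ξ, ζ, cut v e => cut (v.rename ξ ζ) (e.rename ξ ζ)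

/-- `scons s σ` sends the index `0` to `s` and `n + 1` to `σ n`. -/
def scons {k : Kind} (s : Expr k) (σ : ℕ → Expr k) : ℕ → Expr k
  | 0 => s
  | n + 1 => σ n

/-- Simultaneous capture-avoiding substitution of terms for variables (`σ`) and of co-terms for
co-variables (`τ`). -/
def subst : {k : Kind} → (σ : ℕ → Expr .tm) → (τ : ℕ → Expr .co) → Expr k → Expr k
  | _, σ, _, var n => σ n
  | _, σ, τ, mu c => mu (c.subst (fun n => (σ n).rename id Nat.succ)
      (scons (covar 0) (fun n => (τ n).rename id Nat.succ)))
  | _, σ, τ, lam v => lam (v.subst (scons (var 0) (fun n => (σ n).rename Nat.succ id))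
      (fun n => (τ n).rename Nat.succ id))
  | _, _, τ, covar n => τ n
  | _, σ, τ, app v e => app (v.subst σ τ) (e.subst σ τ)
  | _, σ, τ, cut v e => cut (v.subst σ τ) (e.subst σ τ)

/-- `v₁{x := v₂}` for the variable `x` of index `0`. -/
def substVar (v₁ v₂ : Expr .tm) : Expr .tm := v₁.subst (scons v₂ var) covar

/-- `c{α := e}` for the co-variable `α` of index `0`. -/
def substCo (c : Expr .cmd) (e : Expr .co) : Expr .cmd := c.subst var (scons e covar)

end Expr

/-- Typing environments: partial functions from (co-)variables to types. -/
abbrev Ctx : Type := ℕ → Option Ty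

/-- `Γ, 0 : A`, the variables of `Γ` being shifted by one. -/
def Ctx.cons (A : Ty) (Γ : Ctx) : Ctx
  | 0 => some A
  | n + 1 => Γ n

mutual

/-- `Γ ⊢ v : A | Δ` -/
inductive TmTyped : Ctx → Ctx → Expr .tm → Ty → Prop
  | varR {Γ Δ x A} : Γ x = some A → TmTyped Γ Δ (.var x) A
  | activR {Γ Δ c B} : CmdTyped Γ (Ctx.cons B Δ) c → TmTyped Γ Δ (.mu c) B
  | abs {Γ Δ v A B} : TmTyped (Ctx.cons A Γ) Δ v B → TmTyped Γ Δ (.lam v) (.imp A B)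

/-- `Γ | e : A ⊢ Δ` -/
inductive CoTyped : Ctx → Ctx → Expr .co → Ty → Prop
  | varL {Γ Δ α A} : Δ α = some A → CoTyped Γ Δ (.covar α) A
  | appL {Γ Δ v e A B} : TmTyped Γ Δ v A → CoTyped Γ Δ e B → CoTyped Γ Δ (.app v e) (.imp A B)

/-- `c : (Γ ⊢ Δ)` -/
inductive CmdTyped : Ctx → Ctx → Expr .cmd → Prop
  | cut {Γ Δ v e A} : TmTyped Γ Δ v A → CoTyped Γ Δ e A → CmdTyped Γ Δ (.cut v e)

end

open CH.Expr in
/-- Reduction: the contextual closure of the two axioms, on all syntactic categories. -/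
inductive Step : {k : Kind} → Expr k → Expr k → Prop
  /-- `⟨λx.v₁ | v₂ · e⟩ ⟶ ⟨v₁{x := v₂} | e⟩` -/
  | beta (v₁ v₂ : Expr .tm) (e : Expr .co) :
      Step (cut (lam v₁) (app v₂ e)) (cut (v₁.substVar v₂) e)
  /-- `⟨μα.c | e⟩ ⟶ c{α := e}` -/
  | mu (c : Expr .cmd) (e : Expr .co) : Step (cut (mu c) e) (c.substCo e)
  | muBody {c c' : Expr .cmd} : Step c c' → Step (mu c) (mu c')
  | lamBody {v v' : Expr .tm} : Step v v' → Step (lam v) (lam v')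
  | app₁ {v v' : Expr .tm} {e : Expr .co} : Step v v' → Step (app v e) (app v' e)
  | app₂ {v : Expr .tm} {e e' : Expr .co} : Step e e' → Step (app v e) (app v e')
  | cut₁ {v v' : Expr .tm} {e : Expr .co} : Step v v' → Step (cut v e) (cut v' e)
  | cut₂ {v : Expr .tm} {e e' : Expr .co} : Step e e' → Step (cut v e) (cut v e')

end CH

/-! # The T-translation -/

namespace TTranslation

open MELL CH

/-- T-translation of types: `(A ⊃ B)ᵀ = ?!(Aᵀ)^⊥ ⅋ ?Bᵀ`. -/
def ty : Ty → Formula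
  | .atom n => .atom n
  | .imp A B => .par (.why (.ofc (ty A).neg)) (.why (ty B))

/-- Variables (`inl`) and co-variables (`inr`) are both translated to unrestricted variables,
as told by `ι`.  `liftVar ι` is `ι` under a binder for a variable. -/
def liftVar (ι : ℕ ⊕ ℕ → ℕ) : ℕ ⊕ ℕ → ℕ
  | .inl 0 => 0
  | .inl (n + 1) => ι (.inl n) + 1
  | .inr n => ι (.inr n) + 1

/-- `liftCo ι` is `ι` under a binder for a co-variable. -/
def liftCo (ι : ℕ ⊕ ℕ → ℕ) : ℕ ⊕ ℕ → ℕ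
  | .inl n => ι (.inl n) + 1
  | .inr 0 => 0
  | .inr (n + 1) => ι (.inr n) + 1

/-- T-translation of terms, co-terms and commands:
`xᵀ = x`, `(μα.c)ᵀ = ?α.cᵀ`, `(λx.v)ᵀ = ?u.(u ⊥ ⅋(a,b).((vᵀ ⊥ b)[!x := a]))`,
`αᵀ = !α`, `(v · e)ᵀ = !⟨!vᵀ, eᵀ⟩`, `⟨v | e⟩ᵀ = vᵀ ⊥ eᵀ`. -/
def expr : {k : Kind} → (ι : ℕ ⊕ ℕ → ℕ) → Expr k → Term
  | _, ι, .var n => .uvar (ι (.inl n))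
  | _, ι, .mu c => .why (expr (liftCo ι) c)
  | _, ι, .lam v => .why (.cut (.uvar 0)
      (.par (.letOfc (.lvar 1) (.cut (expr (liftVar (fun x => ι x + 1)) v) (.lvar 0)))))
  | _, ι, .covar n => .bang (.uvar (ι (.inr n)))
  | _, ι, .app v e => .bang (.pair (.bang (expr ι v)) (expr ι e))
  | _, ι, .cut v e => .cut (expr ι v) (expr ι e)

open Classical in
/-- The unrestricted environment `?Γᵀ, (Δᵀ)^⊥`: for `ι` injective, it maps the name `ι (inl x)` to
`?Aᵀ` if `x : A` is in `Γ`, the name `ι (inr α)` to `(Aᵀ)^⊥` if `α : A` is in `Δ`, and it is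
undefined elsewhere. -/
noncomputable def ctx (ι : ℕ ⊕ ℕ → ℕ) (Γ Δ : CH.Ctx) : MELL.Ctx :=
  Function.extend ι
    (Sum.elim (fun x => (Γ x).map fun A => .why (ty A)) (fun α => (Δ α).map fun A => (ty A).neg))
    (fun _ => none)

end TTranslation

open MELL MELL.Term Relation

-- Negation, environments, renamings, and erasure of `t[⋆ := ⋆]`.

namespace MELL

-- A translated expression is a linear term without free linear variables, so every linearity side
-- condition of reduction holds and linear renamings or substitutions do not affect it
-- (`expr_closed`, `expr_rename`, `expr_subst_uvar`). Every co-term translates to some `!X = !a.(X ⊥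
-- a)`, with `X` given by `core`.
--
-- Simulation. Since `(X ⊥ a){a \\ ⋆} = X[⋆ := ⋆]`, cutting `?α.t` against `!X` yields `t{α := X[⋆
-- := ⋆]}`, and `[!x := !v]` likewise substitutes `v[⋆ := ⋆]`. Hence translation commutes with
-- substitution only up to reduction: each substituted copy carries a residual `[⋆ := ⋆]`, which one
-- further step erases. This is `steps_subst`, whose invariant `Translates` allows the image of each
-- variable to carry the residual or not. A μ-step is one cut followed by this lemma. A β-step opens
-- `?u`, erases one residual, fires ⅋ against ⊗, fires `[!x := !v₂]`, and then uses the lemma.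
--
-- Typing. The three judgements are treated by mutual recursion on derivations. It is enough that
-- the unrestricted environment contains `?Γᵀ, (Δᵀ)^⊥`, so the auxiliary name `u` in the translation
-- of λ calls for no weakening of typing derivations.
--
-- Throughout, the naming `ι` is arbitrary. Renaming after translation composes with `ι` on one
-- side, renaming before translation on the other, so binders only replace `ι` by a lifted naming.

theorem Formula.neg_neg (A : Formula) : A.neg.neg = A := by
  induction A <;> simp_all [Formula.neg]

theorem Ctx.split_empty_left (Γ : Ctx) : Ctx.Split Γ Ctx.empty Γ := fun _ => .inl ⟨rfl, rfl⟩

theorem Ctx.cons_empty (A : Formula) : Ctx.cons A Ctx.empty = Ctx.single 0 A := by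
  funext n; cases n <;> simp [Ctx.cons, Ctx.single, Ctx.empty]

theorem Ctx.split_cons_cons (A B : Formula) :
    Ctx.Split (Ctx.cons B (Ctx.cons A Ctx.empty)) (Ctx.single 1 A) (Ctx.single 0 B) := by
  rintro (_ | _ | n) <;> simp [Ctx.cons, Ctx.single, Ctx.empty]

@[simp] theorem upRen_id : upRen (fun n => n) = fun n => n := by
  funext n; cases n <;> rfl

theorem upRen_comp (f g : ℕ → ℕ) (n : ℕ) : upRen f (upRen g n) = upRen (fun n => f (g n)) n := by
  cases n <;> rfl

namespace Term

theorem rename_rename (t : Term) : ∀ ξ ζ ξ' ζ' : ℕ → ℕ,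
    (t.rename ξ ζ).rename ξ' ζ' = t.rename (fun n => ξ' (ξ n)) (fun n => ζ' (ζ n)) := by
  induction t <;> intros <;> simp_all [rename, upRen_comp]

theorem rename_bang (ξ ζ : ℕ → ℕ) (t : Term) : (bang t).rename ξ ζ = bang (t.rename ξ ζ) := by
  simp only [bang, rename, shift, rename_rename]
  rfl

/-- The one step of reduction that erases a trivial elimination of the unit. -/
theorem step_letStar_star {t : Term} (ht : t.Linear) : Step (letStar star t) t := by
  have h := Step.root (t := letStar star t) ⟨trivial, ht, fun a => .inl rfl⟩ (Root.one .hole t)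
  -- With the empty elimination context, the contractum is `t` weakened by zero variables.
  have h' : ∀ t : Term, t.rename (fun n => n) (fun n => n) = t := by
    intro t
    induction t <;> simp_all [rename]
  simpa [ECtx.plug, ECtx.nu, ECtx.nl, shift, h'] using h

end Term

end MELL

-- Translations are closed under linear renaming, and linear

namespace TTranslation

/-- The term `X` such that the T-translation of a co-term is `!X`. -/
def core (ι : ℕ ⊕ ℕ → ℕ) : CH.Expr .co → Term
  | .covar n => .uvar (ι (.inr n))
  | .app v e => .pair (.bang (expr ι v)) (expr ι e)

theorem expr_co (ι : ℕ ⊕ ℕ → ℕ) (e : CH.Expr .co) : expr ι e = bang (core ι e) := by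
  cases e <;> rfl

theorem upRen_liftVar (ξ : ℕ → ℕ) (ι : ℕ ⊕ ℕ → ℕ) :
    (fun x => upRen ξ (liftVar ι x)) = liftVar (fun x => ξ (ι x)) := by
  funext x; rcases x with (_ | n) | n <;> rfl

theorem upRen_liftCo (ξ : ℕ → ℕ) (ι : ℕ ⊕ ℕ → ℕ) :
    (fun x => upRen ξ (liftCo ι x)) = liftCo (fun x => ξ (ι x)) := by
  funext x; rcases x with n | (_ | n) <;> rfl

theorem liftVar_map (κ : ℕ ⊕ ℕ → ℕ) :
    (fun x => liftVar κ (Sum.map Nat.succ id x)) = fun x => κ x + 1 := by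
  funext x; rcases x with n | n <;> rfl

theorem liftCo_map (κ : ℕ ⊕ ℕ → ℕ) :
    (fun x => liftCo κ (Sum.map id Nat.succ x)) = fun x => κ x + 1 := by
  funext x; rcases x with n | n <;> rfl

/-- Translations have no free linear variables. -/
theorem expr_rename {k : CH.Kind} (e : CH.Expr k) : ∀ (ι : ℕ ⊕ ℕ → ℕ) (ξ ζ : ℕ → ℕ),
    (expr ι e).rename ξ ζ = expr (fun x => ξ (ι x)) e := by
  induction e <;> intro ι ξ ζ <;>
    simp_all [expr, Term.rename, rename_bang, upRen_liftVar, upRen_liftCo]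
  exact ⟨rfl, rfl, rfl, rfl⟩

theorem core_rename (ι : ℕ ⊕ ℕ → ℕ) (ξ ζ : ℕ → ℕ) (e : CH.Expr .co) :
    (core ι e).rename ξ ζ = core (fun x => ξ (ι x)) e := by
  cases e <;> simp [core, Term.rename, rename_bang, expr_rename]

theorem expr_shift {k : CH.Kind} (ι : ℕ ⊕ ℕ → ℕ) (i j : ℕ) (e : CH.Expr k) :
    (expr ι e).shift i j = expr (fun x => ι x + i) e := expr_rename ..

theorem core_shift (ι : ℕ ⊕ ℕ → ℕ) (i j : ℕ) (e : CH.Expr .co) :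
    (core ι e).shift i j = core (fun x => ι x + i) e := core_rename ..

/-- The weakening hidden in `bang` only moves linear variables, of which a translation has none
free. -/
theorem bang_expr {k : CH.Kind} (ι : ℕ ⊕ ℕ → ℕ) (e : CH.Expr k) :
    bang (expr ι e) = ofc (cut (expr ι e) (lvar 0)) := by
  simp [bang, expr_shift]

theorem bang_core (ι : ℕ ⊕ ℕ → ℕ) (e : CH.Expr .co) :
    bang (core ι e) = ofc (cut (core ι e) (lvar 0)) := by
  simp [bang, core_shift]

theorem expr_covar (ι : ℕ ⊕ ℕ → ℕ) (n : ℕ) :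
    expr ι (.covar n) = ofc (cut (uvar (ι (.inr n))) (lvar 0)) := rfl

theorem expr_app (ι : ℕ ⊕ ℕ → ℕ) (v : CH.Expr .tm) (e : CH.Expr .co) :
    expr ι (.app v e) =
      ofc (cut (pair (ofc (cut (expr ι v) (lvar 0))) (expr ι e)) (lvar 0)) := by
  rw [expr_co, bang_core, core, bang_expr]

theorem expr_closed {k : CH.Kind} (e : CH.Expr k) : ∀ ι : ℕ ⊕ ℕ → ℕ,
    (expr ι e).Linear ∧ ∀ a, (expr ι e).occ a = 0 := by
  induction e with
  | covar n => simp [expr_covar, Linear, occ]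
  | app v e hv he => simp_all [expr_app, Linear, occ]
  -- What is left is arithmetic on the indices 1 and 0 of the variables `a` and `b` bound by ⅋.
  | lam v ih => simpa [expr, Linear, occ, ih] using by omega
  | _ => simp_all [expr, Linear, occ]

theorem expr_linear {k : CH.Kind} (ι : ℕ ⊕ ℕ → ℕ) (e : CH.Expr k) : (expr ι e).Linear :=
  (expr_closed e ι).1

theorem expr_occ {k : CH.Kind} (ι : ℕ ⊕ ℕ → ℕ) (e : CH.Expr k) (a : ℕ) : (expr ι e).occ a = 0 :=
  (expr_closed e ι).2 a

theorem core_linear (ι : ℕ ⊕ ℕ → ℕ) (e : CH.Expr .co) : (core ι e).Linear := by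
  cases e <;> simp [core, bang_expr, Linear, occ, expr_linear, expr_occ]

theorem core_occ (ι : ℕ ⊕ ℕ → ℕ) (e : CH.Expr .co) (a : ℕ) : (core ι e).occ a = 0 := by
  cases e <;> simp [core, bang_expr, occ, expr_occ]

/-! ### Renaming and substitution of translations -/

/-- Only the values of `S` on names in the range of `ι` matter, and `T` is never consulted. The
lemma thus discards substitutions for variables that do not occur in a translation, at the cost of a
change of naming. -/
theorem expr_subst_uvar {k : CH.Kind} (e : CH.Expr k) : ∀ (ι κ : ℕ ⊕ ℕ → ℕ) (S T : ℕ → Term),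
    (∀ x, S (ι x) = uvar (κ x)) → (expr ι e).subst S T = expr κ e := by
  induction e with
  | var n => intro ι κ S T h; exact h _
  | covar n => intro ι κ S T h; simp [expr_covar, subst, h, shift, rename, scons]
  | mu c ih =>
    intro ι κ S T h
    simp only [expr, subst]
    rw [ih _ (liftCo κ)]
    rintro (n | _ | n) <;> simp [liftCo, scons, h, shift, rename]
  | lam v ih =>
    intro ι κ S T h
    simp only [expr, subst]
    rw [ih _ (liftVar fun x => κ x + 1)]
    · rfl
    · rintro ((_ | n) | n) <;> simp [liftVar, scons, h, shift, rename]
  | app v e hv he =>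
    intro ι κ S T h
    simp only [expr_app, subst]
    rw [hv _ κ, he _ κ]
    · rfl
    all_goals intro x; simp [h, shift, rename]
  | cut v e hv he =>
    intro ι κ S T h
    simp only [expr, subst]
    rw [hv _ κ _ _ h, he _ κ _ _ h]

/-- Renaming the source precomposes the naming, whereas renaming the target postcomposes it
(`expr_rename`). Comparing the two lets substitutions be lifted under binders. -/
theorem expr_expr_rename {k : CH.Kind} (e : CH.Expr k) : ∀ (ι : ℕ ⊕ ℕ → ℕ) (ξ ζ : ℕ → ℕ),
    expr ι (e.rename ξ ζ) = expr (fun x => ι (x.map ξ ζ)) e := by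
  induction e with
  | mu c ih =>
    intro ι ξ ζ
    simp only [expr, CH.Expr.rename, ih]
    congr 2; funext x; rcases x with n | (_ | n) <;> rfl
  | lam v ih =>
    intro ι ξ ζ
    simp only [expr, CH.Expr.rename, ih]
    congr 6; funext x; rcases x with (_ | n) | n <;> rfl
  | _ => simp_all [expr, CH.Expr.rename]

theorem core_expr_rename (ι : ℕ ⊕ ℕ → ℕ) (ξ ζ : ℕ → ℕ) (e : CH.Expr .co) :
    core ι (e.rename ξ ζ) = core (fun x => ι (x.map ξ ζ)) e := by
  cases e <;> simp [core, CH.Expr.rename, expr_expr_rename]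

/-! ### Many-step reduction is a congruence -/

theorem steps_cut {t t' s s' : Term} (ht : ReflTransGen MELL.Step t t')
    (hs : ReflTransGen MELL.Step s s') : ReflTransGen MELL.Step (cut t s) (cut t' s') :=
  (ht.lift (cut · s) fun _ _ => .cut₁).trans (hs.lift (cut t') fun _ _ => .cut₂)

theorem steps_pair {t t' s s' : Term} (ht : ReflTransGen MELL.Step t t')
    (hs : ReflTransGen MELL.Step s s') : ReflTransGen MELL.Step (pair t s) (pair t' s') :=
  (ht.lift (pair · s) fun _ _ => .pair₁).trans (hs.lift (pair t') fun _ _ => .pair₂)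

theorem steps_ofc {t t' : Term} (ht : ReflTransGen MELL.Step t t') :
    ReflTransGen MELL.Step (ofc t) (ofc t') := ht.lift ofc fun _ _ => .ofc

theorem steps_why {t t' : Term} (ht : ReflTransGen MELL.Step t t') :
    ReflTransGen MELL.Step (why t) (why t') := ht.lift why fun _ _ => .why

theorem steps_lam {t t' : Term} (ht : ReflTransGen MELL.Step t t') :
    ReflTransGen MELL.Step (why (cut (uvar 0) (par (letOfc (lvar 1) (cut t (lvar 0))))))
      (why (cut (uvar 0) (par (letOfc (lvar 1) (cut t' (lvar 0)))))) :=
  ht.lift (fun t => why (cut (uvar 0) (par (letOfc (lvar 1) (cut t (lvar 0))))))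
    fun _ _ h => .why (.cut₂ (.par (.letOfc₂ (.cut₁ h))))

/-- `t` is `s` or `s[⋆ := ⋆]`. -/
def UpToStar (t s : Term) : Prop := t = s ∨ t = letStar star s

theorem UpToStar.shift {t s : Term} (h : UpToStar t s) (i j : ℕ) :
    UpToStar (t.shift i j) (s.shift i j) := by
  rcases h with rfl | rfl
  · exact .inl rfl
  · exact .inr rfl

theorem UpToStar.steps {t s : Term} (h : UpToStar t s) (hs : s.Linear) :
    ReflTransGen MELL.Step t s := by
  rcases h with rfl | rfl
  · exact .refl
  · exact .single (step_letStar_star hs)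

/-- `S` is, along the namings `ι` and `κ`, the translation of the substitution `(σ, τ)`, up to
eliminations of the unit. -/
structure Translates (ι κ : ℕ ⊕ ℕ → ℕ) (S : ℕ → Term) (σ : ℕ → CH.Expr .tm)
    (τ : ℕ → CH.Expr .co) : Prop where
  var : ∀ n, UpToStar (S (ι (.inl n))) (expr κ (σ n))
  covar : ∀ n, UpToStar (S (ι (.inr n))) (core κ (τ n))

namespace Translates

variable {ι κ : ℕ ⊕ ℕ → ℕ} {S : ℕ → Term} {σ : ℕ → CH.Expr .tm} {τ : ℕ → CH.Expr .co}

theorem shift (h : Translates ι κ S σ τ) (i j : ℕ) :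
    Translates ι (fun x => κ x + i) (fun n => (S n).shift i j) σ τ :=
  ⟨fun n => by simpa only [expr_shift] using (h.var n).shift i j,
    fun n => by simpa only [core_shift] using (h.covar n).shift i j⟩

/-- The name 0 is here the image of no source variable, as with the `?u` in the translation of λ, so
its value `s` is unconstrained. -/
theorem scons (h : Translates ι κ S σ τ) (s : Term) :
    Translates (fun x => ι x + 1) κ (scons s S) σ τ := ⟨h.var, h.covar⟩

theorem liftCo (h : Translates ι κ S σ τ) :
    Translates (liftCo ι) (liftCo κ) (Term.scons (uvar 0) fun n => (S n).shift 1 0)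
      (fun n => (σ n).rename id Nat.succ)
      (CH.Expr.scons (.covar 0) fun n => (τ n).rename id Nat.succ) := by
  constructor
  · intro n
    rw [expr_expr_rename, liftCo_map]
    exact (h.shift 1 0).var n
  · rintro (_ | n)
    · exact .inl rfl
    · simp only [CH.Expr.scons]
      rw [core_expr_rename, liftCo_map]
      exact (h.shift 1 0).covar n

theorem liftVar (h : Translates ι κ S σ τ) :
    Translates (liftVar ι) (liftVar κ) (Term.scons (uvar 0) fun n => (S n).shift 1 0)
      (CH.Expr.scons (.var 0) fun n => (σ n).rename Nat.succ id)
      (fun n => (τ n).rename Nat.succ id) := by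
  constructor
  · rintro (_ | n)
    · exact .inl rfl
    · simp only [CH.Expr.scons]
      rw [expr_expr_rename, liftVar_map]
      exact (h.shift 1 0).var n
  · intro n
    rw [core_expr_rename, liftVar_map]
    exact (h.shift 1 0).covar n

end Translates

/-- The translation commutes with substitution, up to the erasure of eliminations of the unit. -/
theorem steps_subst {k : CH.Kind} (e : CH.Expr k) :
    ∀ {ι κ : ℕ ⊕ ℕ → ℕ} {S : ℕ → Term} {σ : ℕ → CH.Expr .tm} {τ : ℕ → CH.Expr .co} (T : ℕ → Term),
    Translates ι κ S σ τ →
    ReflTransGen MELL.Step ((expr ι e).subst S T) (expr κ (e.subst σ τ)) := by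
  induction e with
  | var n => intro ι κ S σ τ T h; exact (h.var n).steps (expr_linear ..)
  | covar n =>
    intro ι κ S σ τ T h
    simp only [CH.Expr.subst, expr_co, bang_core]
    -- The name of `α` sits inside `!a.(α ⊥ a)`, hence the linear shift; the possible residual is
    -- erased under that `!a`.
    exact steps_ofc (steps_cut (((h.shift 0 1).covar n).steps (core_linear ..)) .refl)
  | mu c ih => intro ι κ S σ τ T h; exact steps_why (ih _ h.liftCo)
  | lam v ih =>
    intro ι κ S σ τ T h
    -- The lifts follow the binders crossed, from the outside in: `?u`, then `⅋(a,b)`, then `[!x :=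
    -- a]`.
    exact steps_lam (ih _ (((h.shift 1 0).scons _).shift 0 2).liftVar)
  | app v e hv he =>
    intro ι κ S σ τ T h
    simp only [CH.Expr.subst, expr_app]
    -- The term lies under two binders `!a` and the co-term under one, whence two linear shifts and
    -- one.
    exact steps_ofc (steps_cut (steps_pair (steps_ofc (steps_cut
      (hv _ ((h.shift 0 1).shift 0 1)) .refl)) (he _ (h.shift 0 1))) .refl)
  | cut v e hv he => intro ι κ S σ τ T h; exact steps_cut (hv _ h) (he _ h)

/-! ### Simulation -/

/-- This is the origin of the residuals: the contra-substituted variable is the right side of the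
cut, so the left side comes back wrapped in `[⋆ := ⋆]`. -/
theorem contraStar_cut {t : Term} (h0 : t.occ 0 = 0) :
    contraStar (cut t (lvar 0)) = letStar star (t.rename id Nat.pred) := by
  simp [contraStar, contra, h0, rename]

theorem step_cutWhy {t s : Term} (ht : t.Linear) (hs : s.Linear)
    (ht0 : ∀ a, t.occ a = 0) (hs0 : ∀ a, s.occ a = 0) :
    MELL.Step (cut (why t) (ofc (cut s (lvar 0))))
      (t.subst (scons (letStar star ((s.rename id Nat.pred).shift 0 0)) uvar) lvar) := by
  have h := MELL.Step.root (t := cut (why t) (ofc (cut s (lvar 0))))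
    (by simp [Linear, occ, ht, hs, ht0, hs0]) (Root.cutWhy .hole .hole t _)
  rw [contraStar_cut (hs0 0)] at h
  exact h

theorem steps_mu (ι : ℕ ⊕ ℕ → ℕ) (c : CH.Expr .cmd) (e : CH.Expr .co) :
    ReflTransGen MELL.Step (expr ι (.cut (.mu c) e)) (expr ι (c.substCo e)) := by
  have h := step_cutWhy (expr_linear (liftCo ι) c) (core_linear ι e) (expr_occ _ c) (core_occ ι e)
  rw [core_rename, core_shift] at h
  simp only [expr]
  rw [expr_co, bang_core]
  -- Only `α`, of index 0, receives a residual; all other variables are substituted exactly.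
  refine .head h (steps_subst c _ ⟨fun n => .inl rfl, ?_⟩)
  rintro (_ | n)
  · exact .inr rfl
  · exact .inl rfl

theorem step_letOfc {ι : ℕ ⊕ ℕ → ℕ} {t : Term} (v : CH.Expr .tm) (ht : t.Linear)
    (ht0 : ∀ a, t.occ a = 0) :
    MELL.Step (letOfc (ofc (cut (expr ι v) (lvar 0))) t)
      (t.subst (scons (letStar star (expr ι v)) uvar) lvar) := by
  have h := MELL.Step.root (t := letOfc (ofc (cut (expr ι v) (lvar 0))) t)
    (by simp [Linear, occ, ht, ht0, expr_linear, expr_occ]) (Root.ofc .hole t _)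
  rw [contraStar_cut (expr_occ ι v 0), expr_rename] at h
  exact h

/-- Write `P = ⟨!v₂, e⟩` and `Q = ⅋(a,b).((v₁ ⊥ b)[!x := a])`, omitting translations. The path is
`?u.(u ⊥ Q) ⊥ !P ⟶ P[⋆ := ⋆] ⊥ Q ⟶ P ⊥ Q ⟶ (v₁ ⊥ e)[!x := !v₂] ⟶ v₁{x := v₂[⋆ := ⋆]} ⊥ e`, after
which the substitution lemma applies to the left side. -/
theorem steps_beta (ι : ℕ ⊕ ℕ → ℕ) (v₁ v₂ : CH.Expr .tm) (e : CH.Expr .co) :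
    ReflTransGen MELL.Step (expr ι (.cut (.lam v₁) (.app v₂ e)))
      (expr ι (.cut (v₁.substVar v₂) e)) := by
  have hp : (core ι (.app v₂ e)).Linear := core_linear ..
  have h₁ := step_cutWhy
    (t := cut (uvar 0) (par (letOfc (lvar 1) (cut (expr (liftVar fun x => ι x + 1) v₁) (lvar 0)))))
    (by simpa [Linear, occ, expr_linear, expr_occ] using by omega) (core_linear ι (.app v₂ e))
    (by simp [occ, expr_occ]) (core_occ ι (.app v₂ e))
  rw [core_rename, core_shift] at h₁
  simp only [subst] at h₁
  -- The name `u` does not occur in the translation of `v₁`, so substituting for it merely lowers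
  -- the other names.
  rw [expr_subst_uvar v₁ _ (liftVar ι)] at h₁
  swap
  · rintro ((_ | n) | n) <;> rfl
  have h₂ : MELL.Step
      (cut (core ι (.app v₂ e)) (par (letOfc (lvar 1) (cut (expr (liftVar ι) v₁) (lvar 0)))))
      (letOfc (ofc (cut (expr ι v₂) (lvar 0))) (cut (expr (liftVar ι) v₁) (expr (fun x => ι x + 1) e))) := by
    rw [core, bang_expr]
    have h := MELL.Step.root (t := cut (pair (ofc (cut (expr ι v₂) (lvar 0))) (expr ι e))
        (par (letOfc (lvar 1) (cut (expr (liftVar ι) v₁) (lvar 0)))))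
      (by simpa [Linear, occ, expr_linear, expr_occ] using by omega)
      -- The pair, substituted for `u`, stands to the left of the cut, while the axiom has it on the
      -- right.
      (Root.cutSymm (Root.cutPar .hole .hole _ _ _))
    simp only [ECtx.plug, ECtx.nu, ECtx.nl, ECtx.rename, subst, scons, Function.iterate_zero, id,
      rename, expr_rename, expr_shift] at h
    rw [expr_subst_uvar v₁ _ (liftVar ι)] at h
    · exact h
    · rintro ((_ | n) | n) <;> rfl
  have h₃ := step_letOfc (ι := ι) v₂
    (t := cut (expr (liftVar ι) v₁) (expr (fun x => ι x + 1) e))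
    (by simp [Linear, expr_linear, expr_occ]) (by simp [occ, expr_occ])
  have h₄ : ReflTransGen MELL.Step
      ((expr (liftVar ι) v₁).subst (scons (letStar star (expr ι v₂)) uvar) lvar)
      (expr ι (v₁.substVar v₂)) := by
    refine steps_subst v₁ _ ⟨?_, fun n => .inl rfl⟩
    rintro (_ | n)
    · exact .inr rfl
    · exact .inl rfl
  simp only [subst] at h₃
  -- The co-term was weakened when it moved under `[!x := _]`; since `x` is not free in it, the
  -- substitution undoes the weakening.
  rw [expr_subst_uvar e _ ι (scons (letStar star (expr ι v₂)) uvar) _ fun _ => rfl] at h₃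
  change ReflTransGen _ (cut (why _) (expr ι (.app v₂ e))) _
  rw [expr_co, bang_core]
  exact .head h₁ (.head (.cut₁ (step_letStar_star hp)) (.head h₂ (.head h₃ (steps_cut h₄ .refl))))

theorem simulation {k : CH.Kind} {t s : CH.Expr k} (h : CH.Step t s) : ∀ ι : ℕ ⊕ ℕ → ℕ,
    ReflTransGen MELL.Step (expr ι t) (expr ι s) := by
  induction h with
  | beta v₁ v₂ e => exact fun ι => steps_beta ι v₁ v₂ e
  | mu c e => exact fun ι => steps_mu ι c e
  | muBody _ ih => exact fun ι => steps_why (ih _)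
  | lamBody _ ih =>
    exact fun ι => steps_lam (ih _)
  | app₁ _ ih =>
    intro ι
    simp only [expr_app]
    exact steps_ofc (steps_cut (steps_pair (steps_ofc (steps_cut (ih ι) .refl)) .refl) .refl)
  | app₂ _ ih =>
    intro ι
    simp only [expr_app]
    exact steps_ofc (steps_cut (steps_pair .refl (ih ι)) .refl)
  | cut₁ _ ih => exact fun ι => steps_cut (ih ι) .refl
  | cut₂ _ ih => exact fun ι => steps_cut .refl (ih ι)

/-! ### Type preservation -/

/-- `D` contains `?Γᵀ, (Δᵀ)^⊥` along the naming `ι`. -/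
structure Agrees (ι : ℕ ⊕ ℕ → ℕ) (Γ Δ : CH.Ctx) (D : MELL.Ctx) : Prop where
  var : ∀ x A, Γ x = some A → D (ι (.inl x)) = some (.why (ty A))
  covar : ∀ α A, Δ α = some A → D (ι (.inr α)) = some (ty A).neg

namespace Agrees

variable {ι : ℕ ⊕ ℕ → ℕ} {Γ Δ : CH.Ctx} {D : MELL.Ctx}

/-- `Agrees` asks for containment only, so the environment may hold names, such as `u`, that come
from no source variable. -/
theorem weaken (h : Agrees ι Γ Δ D) (B : Formula) :
    Agrees (fun x => ι x + 1) Γ Δ (MELL.Ctx.cons B D) := ⟨h.var, h.covar⟩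

theorem liftVar (h : Agrees ι Γ Δ D) (A : CH.Ty) :
    Agrees (liftVar ι) (CH.Ctx.cons A Γ) Δ (MELL.Ctx.cons (.why (ty A)) D) := by
  refine ⟨?_, h.covar⟩
  rintro (_ | n) B hB
  · cases hB; rfl
  · exact h.var n B hB

theorem liftCo (h : Agrees ι Γ Δ D) (A : CH.Ty) :
    Agrees (liftCo ι) Γ (CH.Ctx.cons A Δ) (MELL.Ctx.cons (ty A).neg D) := by
  refine ⟨h.var, ?_⟩
  rintro (_ | n) B hB
  · cases hB; rfl
  · exact h.covar n B hB

end Agrees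

/-- Injectivity of the naming guarantees that no two variables compete for the same entry. -/
theorem agrees_ctx {ι : ℕ ⊕ ℕ → ℕ} (hι : Function.Injective ι) (Γ Δ : CH.Ctx) :
    Agrees ι Γ Δ (ctx ι Γ Δ) := by
  constructor <;> intro x A h <;> simp [ctx, hι.extend_apply, h]

/-- `!t` for a term `t` that the weakening leaves unchanged. -/
theorem typed_ofc_cut {D : MELL.Ctx} {t : Term} {A : Formula}
    (ht : Typed D MELL.Ctx.empty t A) :
    Typed D MELL.Ctx.empty (ofc (cut t (lvar 0))) (.ofc A) :=
  .ofcI (.botI (MELL.Ctx.split_empty_left _) ht (by rw [MELL.Ctx.cons_empty]; exact .ax))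

mutual

theorem typed_tm {Γ Δ : CH.Ctx} {v : CH.Expr .tm} {A : CH.Ty} (h : CH.TmTyped Γ Δ v A)
    {ι : ℕ ⊕ ℕ → ℕ} {D : MELL.Ctx} (hD : Agrees ι Γ Δ D) :
    Typed D MELL.Ctx.empty (expr ι v) (.why (ty A)) := by
  cases h with
  | varR h => exact .uax (hD.var _ _ h)
  | activR h => exact .whyI (typed_cmd h (hD.liftCo _))
  | @abs _ _ _ A B h =>
    refine .whyI (.botI (MELL.Ctx.split_empty_left _) (.uax rfl) ?_)
    rw [Formula.neg_neg]
    refine .parI (.ofcE (MELL.Ctx.split_cons_cons _ _) .ax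
      (.botI (MELL.Ctx.split_empty_left _) (typed_tm h ?_) .ax))
    -- Here `u : ((A ⊃ B)ᵀ)^⊥` and `a : (?!(Aᵀ)^⊥)^⊥`; the latter is `!?Aᵀ` by involutivity, so `[!x
    -- := a]` gives `x : ?Aᵀ`, as the translated environment requires.
    have := (hD.weaken (ty (.imp A B)).neg).liftVar A
    simpa only [Formula.neg, Formula.neg_neg] using this

theorem typed_co {Γ Δ : CH.Ctx} {e : CH.Expr .co} {A : CH.Ty} (h : CH.CoTyped Γ Δ e A)
    {ι : ℕ ⊕ ℕ → ℕ} {D : MELL.Ctx} (hD : Agrees ι Γ Δ D) :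
    Typed D MELL.Ctx.empty (expr ι e) (.ofc (ty A).neg) := by
  cases h with
  | varL h => exact typed_ofc_cut (.uax (hD.covar _ _ h))
  | @appL _ _ v e A B hv he =>
    rw [expr_app]
    refine typed_ofc_cut (.tensorI (MELL.Ctx.split_empty_left _) ?_ (typed_co he hD))
    simp only [Formula.neg, Formula.neg_neg]
    exact typed_ofc_cut (typed_tm hv hD)

theorem typed_cmd {Γ Δ : CH.Ctx} {c : CH.Expr .cmd} (h : CH.CmdTyped Γ Δ c)
    {ι : ℕ ⊕ ℕ → ℕ} {D : MELL.Ctx} (hD : Agrees ι Γ Δ D) :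
    Typed D MELL.Ctx.empty (expr ι c) .bot := by
  cases h with
  | cut hv he => exact .botI (MELL.Ctx.split_empty_left _) (typed_tm hv hD) (typed_co he hD)

end

end TTranslation

theorem mainTheorem11 (ι : ℕ ⊕ ℕ → ℕ) (hι : Function.Injective ι) :
    (∀ (Γ Δ : CH.Ctx) (c : CH.Expr .cmd), CH.CmdTyped Γ Δ c →
      MELL.Typed (TTranslation.ctx ι Γ Δ) MELL.Ctx.empty (TTranslation.expr ι c) .bot) ∧
    (∀ (Γ Δ : CH.Ctx) (e : CH.Expr .co) (A : CH.Ty), CH.CoTyped Γ Δ e A →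
      MELL.Typed (TTranslation.ctx ι Γ Δ) MELL.Ctx.empty (TTranslation.expr ι e)
        (.ofc (TTranslation.ty A).neg)) ∧
    (∀ (Γ Δ : CH.Ctx) (v : CH.Expr .tm) (A : CH.Ty), CH.TmTyped Γ Δ v A →
      MELL.Typed (TTranslation.ctx ι Γ Δ) MELL.Ctx.empty (TTranslation.expr ι v)
        (.why (TTranslation.ty A))) ∧
    (∀ (k : CH.Kind) (t s : CH.Expr k), CH.Step t s →
      Relation.ReflTransGen MELL.Step (TTranslation.expr ι t) (TTranslation.expr ι s)) :=
  ⟨fun _ _ _ h => TTranslation.typed_cmd h (TTranslation.agrees_ctx hι _ _),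
    fun _ _ _ _ h => TTranslation.typed_co h (TTranslation.agrees_ctx hι _ _),
    fun _ _ _ _ h => TTranslation.typed_tm h (TTranslation.agrees_ctx hι _ _),
    fun _ _ _ h => TTranslation.simulation h ι⟩
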